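/- Let $(X,\mathcal X)$ be a measurable space. A class $\mathcal F$ of measurable real-valued functions on $X$ is called an $L_1$-dense class with parameter $D$ and exponent $L$ if for every $0<\varepsilon\le 1$ and every probability measure $\nu$ on $(X,\mathcal X)$ there is a finite set $\{f_1,\dots,f_m\}\subset\mathcal F$ with $m\le D\varepsilon^{-L}$ such that for every $f\in\mathcal F$ there is an index $j$ with $\int|f-f_j|\,d\nu<\varepsilon$. Theorem 1. Let $\mathcal F$ be a finite or countable $L_1$-dense class of functions on $(X,\mathcal X)$ with parameter $D\ge1$ and exponent $L\ge1$ ($D$, $L$ real) such that $\sup_{x\in X}|f(x)|\le1$ for all $f\in\mathcal F$. Let $\xi_1,\dots,\xi_n$, $n\ge2$, be independent and identically distributed random variables with values in $(X,\mathcal X)$ whose common distribution $\mu$ satisfies $\int|f|\,d\mu\le\rho$ for all $f\in\mathcal F$, with a number $0<\rho\le n^{-200}$. Then $$P\Bigl(\sup_{f\in\mathcal F}\Bigl|\sum_{j=1}^n f(\xi_j)\Bigr|\ge u\Bigr)\le D\rho^{Cu}\qquad\text{for all } u>41L$$ with a universal constant $0<C<1$; in fact one can choose $C=\frac1{50}$.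 -/

import Mathlib

open MeasureTheory ProbabilityTheory

/-- `F` is an `L₁`-dense class of functions on the measurable space `X` with parameter `D` and
exponent `L`: its members are measurable, and for every `0 < ε ≤ 1` and every probability measure
`ν` there is a finite subset `G ⊆ F` with at most `D ε^{-L}` elements such that every `f ∈ F` has
`L₁(ν)`-distance less than `ε` from some element of `G`. -/
structure IsL1DenseClass {X : Type*} [MeasurableSpace X] (F : Set (X → ℝ)) (D L : ℝ) : Prop where
  measurable : ∀ f ∈ F, Measurable f
  exists_dense : ∀ ε : ℝ, 0 < ε → ε ≤ 1 → ∀ ν : Measure X, IsProbabilityMeasure ν →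
    ∃ G : Finset (X → ℝ), (G : Set (X → ℝ)) ⊆ F ∧ (G.card : ℝ) ≤ D * ε ^ (-L) ∧
      ∀ f ∈ F, ∃ g ∈ G, ∫⁻ x, ENNReal.ofReal |f x - g x| ∂ν < ENNReal.ofReal ε

/-!
The proof compares the sample with a much larger ghost sample, on which the class `F` is
effectively finite.

Put `M = ⌈ρ⁻¹⌉₊` and take an array of `n * M` independent points with law `μ`, indexed by
`Fin n × Fin M`. A selection `s : Fin n → Fin M` picks one point from each of the `n` groups, and
the selected points again form a sample with the law of `ξ`.

* Ghost sample (`measure_exists_lt_sum_le_two_mul`). Suppose some `f ∈ F` has a large sum of `|f|`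
  over the selected points. The first such `f` in an enumeration of `F` depends on the selected
  points only, so it is independent of the others, over which the sum of `|f|` has expectation at
  most `n M ρ ≤ 2 n`. By Markov's inequality, with conditional probability at least `1 / 2` that
  sum is at most `4 n`. Up to a factor `2` one may therefore assume that `|f|` has total at most
  `5 n` on the whole array.
* Random selection (`IsL1DenseClass.card_selection_exists_le`). Fix the array. Covering `F` at
  scale `1 / (n M)` for the empirical measure of the array leaves at most `D (n M) ^ L` functions,
  at the cost of changing every sum by less than `1`. For one such function, with total mass at
  most `5 n + 1` on the array, the sum over a uniformly random selection has independent summands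
  with total mean `O(n / M) = O(n ρ)`, and Chernoff's bound (`card_selection_lt_sum_le`) with
  `exp t = ρ ^ (-1 / 2)` gives a tail of order `ρ ^ ((u - 2) / 2)`.

Averaging over the selections (`IsL1DenseClass.measureReal_exists_lt_sum_le`) bounds the
probability by a constant times `D (n M) ^ L ρ ^ ((u - 2) / 2)`. As `n M ≤ ρ ^ (-2)` and
`L < u / 41`, the covering number costs only the factor `ρ ^ (-2 u / 41)`, which leaves far more
than `ρ ^ (u / 50)`.
-/

/-! ### Chernoff's bound for a random selection -/

/-- The moment generating function of a sum over a uniformly random selection, multiplied by the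
number of selections. -/
theorem sum_exp_selection_le {α κ : Type*} [Fintype α] [DecidableEq α] [Fintype κ] [Nonempty κ]
    (a : α → κ → ℝ) (ha0 : ∀ i k, 0 ≤ a i k) (ha1 : ∀ i k, a i k ≤ 1) (t : ℝ) :
    ∑ s : α → κ, Real.exp (t * ∑ i, a i (s i)) ≤
      (Fintype.card κ : ℝ) ^ Fintype.card α *
        Real.exp (Real.exp t * (∑ i, ∑ k, a i k) / Fintype.card κ) := by
  have hM : (0 : ℝ) < Fintype.card κ := by exact_mod_cast Fintype.card_pos
  have hcol : ∀ i, ∑ k, Real.exp (t * a i k) ≤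
      Fintype.card κ * Real.exp (Real.exp t * (∑ k, a i k) / Fintype.card κ) := by
    intro i
    -- Convexity of `exp` on `[0, t]` gives `exp (t x) ≤ 1 - x + x exp t`.
    have hpt : ∀ k, Real.exp (t * a i k) ≤ 1 + a i k * Real.exp t := by
      intro k
      have h := convexOn_exp.2 (Set.mem_univ (0 : ℝ)) (Set.mem_univ t)
        (sub_nonneg.2 (ha1 i k)) (ha0 i k) (by ring)
      simp only [smul_eq_mul, mul_zero, zero_add, Real.exp_zero, mul_one] at h
      rw [mul_comm t]
      linarith [ha0 i k]
    calc ∑ k, Real.exp (t * a i k) ≤ ∑ k, (1 + a i k * Real.exp t) :=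
          Finset.sum_le_sum fun k _ => hpt k
      _ = Fintype.card κ * (Real.exp t * (∑ k, a i k) / Fintype.card κ + 1) := by
          rw [Finset.sum_add_distrib, ← Finset.sum_mul]
          simp only [Finset.sum_const, Finset.card_univ, nsmul_eq_mul, mul_one]
          field_simp
          ring
      _ ≤ _ := by
          gcongr
          exact Real.add_one_le_exp _
  calc ∑ s : α → κ, Real.exp (t * ∑ i, a i (s i))
      = ∏ i, ∑ k, Real.exp (t * a i k) := by
        rw [Fintype.prod_sum]
        exact Finset.sum_congr rfl fun s _ => by rw [Finset.mul_sum, Real.exp_sum]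
    _ ≤ ∏ i, (Fintype.card κ * Real.exp (Real.exp t * (∑ k, a i k) / Fintype.card κ)) :=
        Finset.prod_le_prod (fun i _ => Finset.sum_nonneg fun k _ => (Real.exp_pos _).le)
          fun i _ => hcol i
    _ = _ := by
        rw [Finset.prod_mul_distrib, ← Real.exp_sum, Finset.prod_const, Finset.card_univ,
          ← Finset.sum_div, ← Finset.mul_sum]

open scoped Classical in
/-- Chernoff's bound: few selections `s` have `∑ i, a i (s i) > w` when the total mass `A` of the
array is small compared with the number of points in each group. -/
theorem card_selection_lt_sum_le {α κ : Type*} [Fintype α] [Fintype κ] [Nonempty κ]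
    (a : α → κ → ℝ) (ha0 : ∀ i k, 0 ≤ a i k) (ha1 : ∀ i k, a i k ≤ 1) {A : ℝ}
    (hA : ∑ i, ∑ k, a i k ≤ A) {t : ℝ} (ht : 0 ≤ t) (w : ℝ) :
    ((Finset.univ.filter fun s : α → κ => w < ∑ i, a i (s i)).card : ℝ) ≤
      (Fintype.card κ : ℝ) ^ Fintype.card α *
        (Real.exp (Real.exp t * A / Fintype.card κ) * Real.exp (-(t * w))) := by
  have hle : ((Finset.univ.filter fun s : α → κ => w < ∑ i, a i (s i)).card : ℝ) ≤
      (∑ s : α → κ, Real.exp (t * ∑ i, a i (s i))) * Real.exp (-(t * w)) := by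
    rw [Finset.card_eq_sum_ones, Nat.cast_sum, Finset.sum_mul, Finset.sum_filter]
    refine Finset.sum_le_sum fun s _ => ?_
    split_ifs with h
    · rw [← Real.exp_add, Nat.cast_one]
      exact Real.one_le_exp (by nlinarith)
    · positivity
  refine hle.trans ?_
  rw [← mul_assoc]
  gcongr
  refine (sum_exp_selection_le a ha0 ha1 t).trans ?_
  gcongr

/-! ### Covering the class on a finite sample -/

/-- On a sample of `N` points an `L₁`-dense class can be replaced by at most `D N ^ L` of its
members, at the cost of changing each sum over the sample by less than `1`: this is the covering
at scale `1 / N` for the empirical measure. -/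
theorem IsL1DenseClass.exists_net_sample {X ι : Type*} [MeasurableSpace X] [Fintype ι] [Nonempty ι]
    {F : Set (X → ℝ)} {D L : ℝ} (hF : IsL1DenseClass F D L) (y : ι → X) :
    ∃ G : Finset (X → ℝ), (G : Set (X → ℝ)) ⊆ F ∧
      (G.card : ℝ) ≤ D * (Fintype.card ι : ℝ) ^ L ∧
      ∀ f ∈ F, ∃ g ∈ G, ∑ i, |f (y i) - g (y i)| < 1 := by
  have hN : (0 : ℝ) < Fintype.card ι := by exact_mod_cast Fintype.card_pos
  have hN1 : (1 : ℝ) ≤ Fintype.card ι := by exact_mod_cast Fintype.card_pos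
  have hNE : (Fintype.card ι : ENNReal) ≠ 0 := by exact_mod_cast Fintype.card_ne_zero
  have hNT : (Fintype.card ι : ENNReal) ≠ ⊤ := ENNReal.natCast_ne_top _
  let ν : Measure X := (Fintype.card ι : ENNReal)⁻¹ • ∑ i, Measure.dirac (y i)
  have hν : IsProbabilityMeasure ν := ⟨by
    simp only [ν, Measure.smul_apply, Measure.finsetSum_apply, measure_univ, smul_eq_mul,
      Finset.sum_const, Finset.card_univ, nsmul_eq_mul, mul_one]
    exact ENNReal.inv_mul_cancel hNE hNT⟩
  obtain ⟨G, hGF, hGc, hG⟩ := hF.exists_dense (Fintype.card ι : ℝ)⁻¹ (inv_pos.2 hN)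
    (inv_le_one_of_one_le₀ hN1) ν hν
  refine ⟨G, hGF, ?_, fun f hf => ?_⟩
  · rwa [Real.inv_rpow hN.le, Real.rpow_neg hN.le, inv_inv] at hGc
  · obtain ⟨g, hg, hfg⟩ := hG f hf
    refine ⟨g, hg, ?_⟩
    have hmeas : Measurable fun x => ENNReal.ofReal |f x - g x| :=
      ((hF.measurable f hf).sub (hF.measurable g (hGF hg))).abs.ennreal_ofReal
    have hint : ∫⁻ x, ENNReal.ofReal |f x - g x| ∂ν =
        (Fintype.card ι : ENNReal)⁻¹ * ENNReal.ofReal (∑ i, |f (y i) - g (y i)|) := by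
      rw [lintegral_smul_measure, lintegral_finsetSum_measure,
        ENNReal.ofReal_sum_of_nonneg fun _ _ => abs_nonneg _, smul_eq_mul]
      simp only [lintegral_dirac' _ hmeas]
    rw [hint, ENNReal.ofReal_inv_of_pos hN, ENNReal.ofReal_natCast] at hfg
    rw [← ENNReal.ofReal_lt_one]
    by_contra! h
    exact absurd hfg (not_lt.2 (le_mul_of_one_le_right' h))

open scoped Classical in
/-- Union bound over a covering of the class: for a fixed array of points, few selections make the
sum of `|f|` exceed `v` for some `f ∈ F` whose total over the array is at most `A`. -/
theorem IsL1DenseClass.card_selection_exists_le {X α κ : Type*} [MeasurableSpace X]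
    [Fintype α] [Nonempty α] [Fintype κ] [Nonempty κ]
    {F : Set (X → ℝ)} {D L : ℝ} (hF : IsL1DenseClass F D L) (hF1 : ∀ f ∈ F, ∀ x, |f x| ≤ 1)
    (y : α × κ → X) {A v t : ℝ} (ht : 0 ≤ t) :
    ((Finset.univ.filter fun s : α → κ =>
        ∃ f ∈ F, v < ∑ i, |f (y (i, s i))| ∧ ∑ p, |f (y p)| ≤ A).card : ℝ) ≤
      D * ((Fintype.card α * Fintype.card κ : ℕ) : ℝ) ^ L *
        ((Fintype.card κ : ℝ) ^ Fintype.card α *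
          (Real.exp (Real.exp t * (A + 1) / Fintype.card κ) * Real.exp (-(t * (v - 1))))) := by
  obtain ⟨G, hGF, hGc, hG⟩ := hF.exists_net_sample y
  rw [Fintype.card_prod] at hGc
  set bnd : ℝ := (Fintype.card κ : ℝ) ^ Fintype.card α *
    (Real.exp (Real.exp t * (A + 1) / Fintype.card κ) * Real.exp (-(t * (v - 1))))
  have hbnd0 : 0 ≤ bnd := by positivity
  -- Only members of the net whose total mass is small can approximate the functions that count.
  let G' := G.filter fun g => ∑ i, ∑ k, |g (y (i, k))| ≤ A + 1
  have hsub : (Finset.univ.filter fun s : α → κ =>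
        ∃ f ∈ F, v < ∑ i, |f (y (i, s i))| ∧ ∑ p, |f (y p)| ≤ A) ⊆
      G'.biUnion fun g => Finset.univ.filter fun s : α → κ => v - 1 < ∑ i, |g (y (i, s i))| := by
    intro s hs
    obtain ⟨f, hf, hv, hA⟩ := (Finset.mem_filter.1 hs).2
    obtain ⟨g, hg, hfg⟩ := hG f hf
    have hsel : ∑ i, |f (y (i, s i)) - g (y (i, s i))| ≤ ∑ p, |f (y p) - g (y p)| := by
      rw [Fintype.sum_prod_type]
      exact Finset.sum_le_sum fun i _ => Finset.single_le_sum
        (f := fun k => |f (y (i, k)) - g (y (i, k))|) (fun _ _ => abs_nonneg _)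
        (Finset.mem_univ (s i))
    have h1 : ∑ i, |f (y (i, s i))| ≤
        ∑ i, |g (y (i, s i))| + ∑ i, |f (y (i, s i)) - g (y (i, s i))| := by
      rw [← Finset.sum_add_distrib]
      refine Finset.sum_le_sum fun i _ => ?_
      have := abs_sub_abs_le_abs_sub (f (y (i, s i))) (g (y (i, s i)))
      linarith
    have h2 : ∑ p, |g (y p)| ≤ ∑ p, |f (y p)| + ∑ p, |f (y p) - g (y p)| := by
      rw [← Finset.sum_add_distrib]
      refine Finset.sum_le_sum fun p _ => ?_
      have := abs_sub_abs_le_abs_sub (g (y p)) (f (y p))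
      rw [abs_sub_comm] at this
      linarith
    refine Finset.mem_biUnion.2 ⟨g, Finset.mem_filter.2 ⟨hg, ?_⟩,
      Finset.mem_filter.2 ⟨Finset.mem_univ _, by linarith⟩⟩
    rw [← Fintype.sum_prod_type']
    linarith
  calc ((Finset.univ.filter fun s : α → κ =>
        ∃ f ∈ F, v < ∑ i, |f (y (i, s i))| ∧ ∑ p, |f (y p)| ≤ A).card : ℝ)
      ≤ ∑ g ∈ G', ((Finset.univ.filter fun s : α → κ =>
          v - 1 < ∑ i, |g (y (i, s i))|).card : ℝ) := by
        exact_mod_cast (Finset.card_le_card hsub).trans Finset.card_biUnion_le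
    _ ≤ ∑ _g ∈ G', bnd := Finset.sum_le_sum fun g hg =>
        card_selection_lt_sum_le (fun i k => |g (y (i, k))|) (fun _ _ => abs_nonneg _)
          (fun _ _ => hF1 g (hGF (Finset.mem_filter.1 hg).1) _) (Finset.mem_filter.1 hg).2 ht _
    _ = G'.card * bnd := by rw [Finset.sum_const, nsmul_eq_mul]
    _ ≤ _ := by
        gcongr
        refine le_trans ?_ hGc
        exact_mod_cast Finset.card_le_card (Finset.filter_subset _ _)

/-! ### Comparison with a ghost sample -/

/-- If the events `B i` are jointly independent of the events `C i`, each of probability at least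
`1 / 2`, then intersecting `B i` with `C i` costs at most a factor `2` in the probability of the
union: the first `i` for which `B i` occurs is independent of all the `C i`. -/
theorem measure_iUnion_le_two_mul_of_indep {Ω : Type*} {m₁ m₂ m₀ : MeasurableSpace Ω}
    {P : Measure Ω} (hm₁ : m₁ ≤ m₀) (hm₂ : m₂ ≤ m₀) (hind : Indep m₁ m₂ P)
    {B C : ℕ → Set Ω} (hB : ∀ i, MeasurableSet[m₁] (B i)) (hC : ∀ i, MeasurableSet[m₂] (C i))
    (hC2 : ∀ i, 2⁻¹ ≤ P (C i)) :
    P (⋃ i, B i) ≤ 2 * P (⋃ i, B i ∩ C i) := by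
  have hd : ∀ i, MeasurableSet[m₁] (disjointed B i) := fun i => MeasurableSet.disjointed hB i
  calc P (⋃ i, B i) = ∑' i, P (disjointed B i) := by
        rw [← iUnion_disjointed, measure_iUnion (disjoint_disjointed B) fun i => hm₁ _ (hd i)]
    _ ≤ ∑' i, 2 * P (disjointed B i ∩ C i) := by
        refine ENNReal.tsum_le_tsum fun i => ?_
        rw [(Indep_iff m₁ m₂ P).1 hind _ _ (hd i) (hC i)]
        calc P (disjointed B i) = 2 * (P (disjointed B i) * 2⁻¹) := by
              rw [mul_left_comm, ENNReal.mul_inv_cancel (by simp) (by simp), mul_one]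
          _ ≤ _ := by gcongr; exact hC2 i
    _ = 2 * P (⋃ i, disjointed B i ∩ C i) := by
        rw [ENNReal.tsum_mul_left, measure_iUnion]
        · exact fun i j hij => (disjoint_disjointed B hij).mono Set.inter_subset_left
            Set.inter_subset_left
        · exact fun i => (hm₁ _ (hd i)).inter (hm₂ _ (hC i))
    _ ≤ _ := by
        gcongr with i
        exact disjointed_le B i

/-- Markov's inequality for the sum of `|f|` over the ghost points indexed by `T`. -/
theorem half_le_measure_sum_le {X ι : Type*} [MeasurableSpace X] [Fintype ι]
    (μ : Measure X) [IsProbabilityMeasure μ] {f : X → ℝ} (hf : Measurable f)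
    (hf1 : ∀ x, |f x| ≤ 1) {ρ : ℝ} (hfρ : ∫ x, |f x| ∂μ ≤ ρ) (T : Finset ι) {a : ℝ} (ha : 0 < a)
    (hTa : 2 * (T.card * ρ) ≤ a) :
    2⁻¹ ≤ Measure.pi (fun _ : ι => μ) {y | ∑ i ∈ T, |f (y i)| ≤ a} := by
  set Q := Measure.pi (fun _ : ι => μ)
  have hmeas : ∀ i : ι, Measurable fun y : ι → X => |f (y i)| := fun i =>
    (hf.comp (measurable_pi_apply i)).abs
  have hint : ∀ i : ι, Integrable (fun y : ι → X => |f (y i)|) Q := fun i =>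
    Integrable.of_bound (hmeas i).aestronglyMeasurable 1
      (Filter.Eventually.of_forall fun y => by simpa using hf1 (y i))
  have hE : ∫ y, ∑ i ∈ T, |f (y i)| ∂Q ≤ T.card * ρ := by
    rw [integral_finsetSum _ fun i _ => hint i]
    calc ∑ i ∈ T, ∫ y, |f (y i)| ∂Q = ∑ i ∈ T, ∫ x, |f x| ∂μ := by
          refine Finset.sum_congr rfl fun i _ => ?_
          have := (measurePreserving_eval (fun _ : ι => μ) i).map_eq
          conv_rhs => rw [← this]
          rw [integral_map (measurable_pi_apply i).aemeasurable hf.abs.aestronglyMeasurable]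
      _ ≤ ∑ i ∈ T, ρ := Finset.sum_le_sum fun i _ => hfρ
      _ = _ := by rw [Finset.sum_const, nsmul_eq_mul]
  have hmk := mul_meas_ge_le_integral_of_nonneg (μ := Q) (f := fun y => ∑ i ∈ T, |f (y i)|)
    (Filter.Eventually.of_forall fun y => Finset.sum_nonneg fun i _ => abs_nonneg _)
    (integrable_finsetSum _ fun i _ => hint i) a
  have hhalf : Q.real {y | a ≤ ∑ i ∈ T, |f (y i)|} ≤ 2⁻¹ := by
    rw [← mul_le_mul_iff_right₀ ha]
    linarith
  have hms : MeasurableSet {y : ι → X | ∑ i ∈ T, |f (y i)| ≤ a} :=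
    measurableSet_le (Finset.measurable_sum _ fun i _ => hmeas i) measurable_const
  have hcompl : Q.real {y | ∑ i ∈ T, |f (y i)| ≤ a}ᶜ ≤ 2⁻¹ :=
    by
    refine le_trans (measureReal_mono ?_) hhalf
    intro y hy
    simp only [Set.mem_compl_iff, Set.mem_ofPred_eq, not_le] at hy ⊢
    exact hy.le
  rw [measureReal_compl hms, probReal_univ] at hcompl
  have : ENNReal.ofReal 2⁻¹ ≤ ENNReal.ofReal (Q.real {y | ∑ i ∈ T, |f (y i)| ≤ a}) :=
    ENNReal.ofReal_le_ofReal (by linarith)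
  rwa [ofReal_measureReal, ENNReal.ofReal_inv_of_pos two_pos, ENNReal.ofReal_ofNat] at this

/-- If the sum of some `|f k|` over the points indexed by `S` exceeds `v`, then, up to a factor `2`
in probability, some such `f k` also has a small sum over the ghost points indexed by `T`. -/
theorem measure_exists_lt_sum_le_two_mul {X ι : Type*} [MeasurableSpace X] [Fintype ι]
    (μ : Measure X) [IsProbabilityMeasure μ] (f : ℕ → X → ℝ) (hf : ∀ k, Measurable (f k))
    (hf1 : ∀ k x, |f k x| ≤ 1) {ρ : ℝ} (hfρ : ∀ k, ∫ x, |f k x| ∂μ ≤ ρ) {S T : Finset ι}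
    (hST : Disjoint S T) {a : ℝ} (ha : 0 < a) (hTa : 2 * (T.card * ρ) ≤ a) (v : ℝ) :
    Measure.pi (fun _ : ι => μ) {y | ∃ k, v < ∑ i ∈ S, |f k (y i)|} ≤
      2 * Measure.pi (fun _ : ι => μ)
        {y | ∃ k, v < ∑ i ∈ S, |f k (y i)| ∧ ∑ i ∈ T, |f k (y i)| ≤ a} := by
  set Q := Measure.pi (fun _ : ι => μ)
  have hiind : iIndepFun (fun (i : ι) (y : ι → X) => y i) Q :=
    iIndepFun_pi (X := fun _ : ι => (id : X → X)) fun _ => aemeasurable_id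
  have hind := hiind.indepFun_finset S T hST fun i => measurable_pi_apply i
  have hres : ∀ U : Finset ι, Measurable fun (y : ι → X) (i : U) => y i := fun U =>
    measurable_pi_lambda _ fun i => measurable_pi_apply _
  have hmeas : ∀ (U : Finset ι) (k : ℕ), Measurable fun z : U → X => ∑ i, |f k (z i)| :=
    fun U k => Finset.measurable_sum _ fun i _ => ((hf k).comp (measurable_pi_apply i)).abs
  have hsum : ∀ (U : Finset ι) (k : ℕ) (y : ι → X),
      ∑ i : U, |f k (y i)| = ∑ i ∈ U, |f k (y i)| := fun U k y =>
    Finset.sum_coe_sort U fun i => |f k (y i)|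
  have key := measure_iUnion_le_two_mul_of_indep (P := Q) (hres S).comap_le (hres T).comap_le hind
    (B := fun k => {y | v < ∑ i ∈ S, |f k (y i)|}) (C := fun k => {y | ∑ i ∈ T, |f k (y i)| ≤ a})
    (fun k => ⟨{z | v < ∑ i, |f k (z i)|}, measurableSet_lt measurable_const (hmeas S k), by
      ext y; simp only [Set.mem_preimage, Set.mem_ofPred_eq, hsum]⟩)
    (fun k => ⟨{z | ∑ i, |f k (z i)| ≤ a}, measurableSet_le (hmeas T k) measurable_const, by
      ext y; simp only [Set.mem_preimage, Set.mem_ofPred_eq, hsum]⟩)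
    (fun k => half_le_measure_sum_le μ (hf k) (hf1 k) (hfρ k) T ha hTa)
  simpa only [← Set.ofPred_exists, ← Set.ofPred_and] using key

/-! ### The tail bound -/

open scoped Classical in
/-- Tail bound with free parameters: `κ` is the size of the groups in the ghost array, `a` the
bound for the sums over the ghost points, and `t` the parameter in Chernoff's bound. -/
theorem IsL1DenseClass.measureReal_exists_lt_sum_le {X α κ : Type*} [MeasurableSpace X]
    [Fintype α] [Nonempty α] [Fintype κ] [Nonempty κ] {F : Set (X → ℝ)} {D L : ℝ}
    (hF : IsL1DenseClass F D L) (hFc : F.Countable) (hF1 : ∀ f ∈ F, ∀ x, |f x| ≤ 1)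
    (μ : Measure X) [IsProbabilityMeasure μ] {ρ : ℝ} (hρ : 0 ≤ ρ)
    (hFρ : ∀ f ∈ F, ∫ x, |f x| ∂μ ≤ ρ) {a : ℝ} (ha : 0 < a)
    (hρa : 2 * ((Fintype.card α * Fintype.card κ : ℕ) * ρ) ≤ a) (v : ℝ) {t : ℝ} (ht : 0 ≤ t) :
    (Measure.pi fun _ : α => μ).real {x | ∃ f ∈ F, v < ∑ i, |f (x i)|} ≤
      2 * (D * ((Fintype.card α * Fintype.card κ : ℕ) : ℝ) ^ L *
        (Real.exp (Real.exp t * (Fintype.card α + a + 1) / Fintype.card κ) *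
          Real.exp (-(t * (v - 1))))) := by
  rcases F.eq_empty_or_nonempty with rfl | hne
  · obtain ⟨G, -, hGc, -⟩ := hF.exists_dense 1 one_pos le_rfl
      μ inferInstance
    have hD : 0 ≤ D := by
      rw [Real.one_rpow, mul_one] at hGc
      exact (Nat.cast_nonneg _).trans hGc
    simp only [Set.mem_empty_iff_false, false_and, exists_false, Set.ofPred_false,
      measureReal_empty]
    positivity
  obtain ⟨f, rfl⟩ := hFc.exists_eq_range hne
  have hfm : ∀ k, Measurable (f k) := fun k => hF.measurable _ ⟨k, rfl⟩
  have hf1 : ∀ k x, |f k x| ≤ 1 := fun k => hF1 _ ⟨k, rfl⟩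
  have hfρ : ∀ k, ∫ x, |f k x| ∂μ ≤ ρ := fun k => hFρ _ ⟨k, rfl⟩
  set A : ℝ := Fintype.card α + a with hA
  set Q := Measure.pi fun _ : α × κ => μ
  let E : (α → κ) → Set (α × κ → X) := fun s =>
    {y | ∃ g ∈ Set.range f, v < ∑ i, |g (y (i, s i))| ∧ ∑ p, |g (y p)| ≤ A}
  have hEm : ∀ s, MeasurableSet (E s) := by
    intro s
    have : E s = ⋃ k, {y | v < ∑ i, |f k (y (i, s i))|} ∩ {y | ∑ p, |f k (y p)| ≤ A} := by
      ext y; simp [E]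
    rw [this]
    refine MeasurableSet.iUnion fun k => MeasurableSet.inter
      (measurableSet_lt measurable_const ?_) (measurableSet_le ?_ measurable_const)
    · exact Finset.measurable_sum _ fun i _ => ((hfm k).comp (measurable_pi_apply _)).abs
    · exact Finset.measurable_sum _ fun i _ => ((hfm k).comp (measurable_pi_apply _)).abs
  -- For every selection, the selected points have the law of the original sample.
  have hghost : ∀ s, (Measure.pi fun _ : α => μ).real {x | ∃ g ∈ Set.range f, v < ∑ i, |g (x i)|} ≤
      2 * Q.real (E s) := by
    intro s
    have hinj : Function.Injective fun i : α => (i, s i) := fun i j h => (Prod.mk.inj h).1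
    let S : Finset (α × κ) := Finset.univ.image fun i => (i, s i)
    have hS : ∀ (k : ℕ) (y : α × κ → X), ∑ p ∈ S, |f k (y p)| = ∑ i, |f k (y (i, s i))| :=
      fun k y => Finset.sum_image hinj.injOn
    have hiind : iIndepFun (fun (p : α × κ) (y : α × κ → X) => y p) Q :=
      iIndepFun_pi (X := fun _ : α × κ => (id : X → X)) fun _ => aemeasurable_id
    have hmap : Q.map (fun y i => y (i, s i)) = Measure.pi fun _ : α => μ := by
      rw [(iIndepFun_iff_map_fun_eq_pi_map fun i => (measurable_pi_apply _).aemeasurable).1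
        (hiind.precomp hinj)]
      congr 1
      funext i
      exact (measurePreserving_eval (fun _ : α × κ => μ) (i, s i)).map_eq
    have hBm : MeasurableSet {x : α → X | ∃ g ∈ Set.range f, v < ∑ i, |g (x i)|} := by
      have : {x : α → X | ∃ g ∈ Set.range f, v < ∑ i, |g (x i)|} =
          ⋃ k, {x | v < ∑ i, |f k (x i)|} := by
        ext y; simp
      rw [this]
      exact MeasurableSet.iUnion fun k => measurableSet_lt measurable_const
        (Finset.measurable_sum _ fun i _ => ((hfm k).comp (measurable_pi_apply _)).abs)
    have hT : 2 * ((Sᶜ.card : ℝ) * ρ) ≤ a := by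
      refine le_trans ?_ hρa
      gcongr
      rw [← Fintype.card_prod]
      exact Finset.card_le_univ _
    have h := measure_exists_lt_sum_le_two_mul μ f hfm hf1 hfρ
      (disjoint_compl_right (a := S)) ha hT v
    have hpi : (Measure.pi fun _ : α => μ) {x | ∃ g ∈ Set.range f, v < ∑ i, |g (x i)|} ≤
        2 * Q (E s) := by
      rw [← hmap, Measure.map_apply
        (measurable_pi_lambda _ fun i => measurable_pi_apply _) hBm]
      have hl : (fun (y : α × κ → X) i => y (i, s i)) ⁻¹'
          {x | ∃ g ∈ Set.range f, v < ∑ i, |g (x i)|} =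
          {y | ∃ k, v < ∑ i ∈ S, |f k (y i)|} := by
        ext y; simp [hS]
      rw [hl]
      refine h.trans ?_
      gcongr
      rintro y ⟨k, hk, hk'⟩
      refine ⟨f k, ⟨k, rfl⟩, by rwa [hS] at hk, ?_⟩
      rw [← Finset.sum_add_sum_compl S, hS, hA]
      refine add_le_add ?_ hk'
      calc ∑ i, |f k (y (i, s i))| ≤ ∑ _i : α, (1 : ℝ) := Finset.sum_le_sum fun i _ => hf1 k _
        _ = Fintype.card α := by simp
    have := ENNReal.toReal_mono (by finiteness) hpi
    simpa [measureReal_def] using this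
  -- For every fixed array the number of selections `s` with `y ∈ E s` is bounded.
  have havg : ∑ s, Q.real (E s) ≤ D * ((Fintype.card α * Fintype.card κ : ℕ) : ℝ) ^ L *
        ((Fintype.card κ : ℝ) ^ Fintype.card α *
          (Real.exp (Real.exp t * (A + 1) / Fintype.card κ) * Real.exp (-(t * (v - 1))))) := by
    have hii : ∀ s, Integrable ((E s).indicator (1 : (α × κ → X) → ℝ)) Q := fun s =>
      (integrable_const (1 : ℝ)).indicator (hEm s)
    calc ∑ s, Q.real (E s) = ∫ y, ∑ s, (E s).indicator (1 : (α × κ → X) → ℝ) y ∂Q := by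
          rw [integral_finsetSum _ fun s _ => hii s]
          exact Finset.sum_congr rfl fun s _ => (integral_indicator_one (hEm s)).symm
      _ ≤ ∫ _y, (D * ((Fintype.card α * Fintype.card κ : ℕ) : ℝ) ^ L *
          ((Fintype.card κ : ℝ) ^ Fintype.card α *
          (Real.exp (Real.exp t * (A + 1) / Fintype.card κ) *
            Real.exp (-(t * (v - 1)))))) ∂Q := by
          refine integral_mono (integrable_finsetSum _ fun s _ => hii s) (integrable_const _) ?_
          intro y
          refine le_trans (le_of_eq ?_) (hF.card_selection_exists_le hF1 y (A := A) (v := v) ht)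
          rw [Finset.card_eq_sum_ones, Nat.cast_sum, Finset.sum_filter]
          refine Finset.sum_congr rfl fun s _ => ?_
          simp only [Set.indicator_apply, Pi.one_apply, Nat.cast_one]
          rfl
      _ = _ := by simp
  have hsum := Finset.sum_le_sum fun s (_ : s ∈ (Finset.univ : Finset (α → κ))) => hghost s
  rw [Finset.sum_const, Finset.card_univ, Fintype.card_fun, nsmul_eq_mul, ← Finset.mul_sum,
    Nat.cast_pow] at hsum
  have hM : (0 : ℝ) < (Fintype.card κ : ℝ) ^ Fintype.card α := by
    have : (0 : ℝ) < Fintype.card κ := by exact_mod_cast Fintype.card_pos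
    positivity
  rw [← mul_le_mul_iff_right₀ hM]
  linarith

/-- The parameters `M = ⌈ρ⁻¹⌉₊`, `a = 4 n`, `exp t = ρ ^ (-1 / 2)` and `v = u - 1` turn the tail
bound into `D ρ ^ (u / 50)`. -/
theorem two_mul_ghost_bound_le {n : ℕ} (hn : 2 ≤ n) {D L ρ u : ℝ} (hD : 1 ≤ D) (hL : 1 ≤ L)
    (hρ0 : 0 < ρ) (hρn : ρ ≤ (n : ℝ) ^ (-200 : ℤ)) (hu : 41 * L < u) :
    2 * (D * ((n * ⌈ρ⁻¹⌉₊ : ℕ) : ℝ) ^ L *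
      (Real.exp (Real.exp (-Real.log ρ / 2) * (n + 4 * n + 1) / ⌈ρ⁻¹⌉₊) *
        Real.exp (-(-Real.log ρ / 2 * (u - 1 - 1))))) ≤ D * ρ ^ ((1 / 50 : ℝ) * u) := by
  have hn2 : (2 : ℝ) ≤ n := by exact_mod_cast hn
  have hn0 : (0 : ℝ) < n := by linarith
  have hn8 : (36 * n ^ 2) * ρ ≤ 1 := by
    have h1 : ρ ≤ ((n : ℝ) ^ 8)⁻¹ := by
      refine hρn.trans ?_
      rw [← zpow_natCast, ← zpow_neg]
      exact zpow_le_zpow_right₀ (by linarith) (by norm_num)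
    have h2 : (36 : ℝ) ≤ n ^ 6 := le_trans (by norm_num) (pow_le_pow_left₀ (by norm_num) hn2 6)
    calc (36 * (n : ℝ) ^ 2) * ρ ≤ (n ^ 6 * n ^ 2) * ((n : ℝ) ^ 8)⁻¹ := by gcongr
      _ = 1 := by rw [← pow_add]; exact mul_inv_cancel₀ (by positivity)
  have hρ6 : 6 * ρ ≤ 1 := by nlinarith
  have hρ1 : ρ ≤ 1 := by linarith
  have hM1 : ρ⁻¹ ≤ ⌈ρ⁻¹⌉₊ := Nat.le_ceil _
  have hM2 : (⌈ρ⁻¹⌉₊ : ℝ) ≤ ρ⁻¹ + 1 := (Nat.ceil_lt_add_one (by positivity)).le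
  have hM0 : (0 : ℝ) < ⌈ρ⁻¹⌉₊ := lt_of_lt_of_le (by positivity) hM1
  -- The covering number: `n M ≤ ρ ^ (-2)` and `L < u / 41`.
  have hcov : ((n * ⌈ρ⁻¹⌉₊ : ℕ) : ℝ) ^ L ≤ ρ ^ (-(2 * u / 41)) := by
    have hN : ((n * ⌈ρ⁻¹⌉₊ : ℕ) : ℝ) ≤ ρ ^ (-2 : ℝ) := by
      rw [Real.rpow_neg hρ0.le, Real.rpow_two, Nat.cast_mul, le_inv_comm₀ (by positivity)
        (by positivity), ← one_div, le_div_iff₀ (by positivity)]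
      have : ρ * (ρ⁻¹ + 1) = 1 + ρ := by field_simp
      calc ρ ^ 2 * (n * ⌈ρ⁻¹⌉₊) ≤ ρ ^ 2 * (n * (ρ⁻¹ + 1)) := by gcongr
        _ = ρ * n * (ρ * (ρ⁻¹ + 1)) := by ring
        _ = ρ * n * (1 + ρ) := by rw [this]
        _ ≤ ρ * n * 2 := by gcongr; linarith
        _ ≤ 1 := by nlinarith
    calc ((n * ⌈ρ⁻¹⌉₊ : ℕ) : ℝ) ^ L ≤ (ρ ^ (-2 : ℝ)) ^ L := by gcongr
      _ = ρ ^ (-2 * L) := (Real.rpow_mul hρ0.le _ _).symm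
      _ ≤ _ := Real.rpow_le_rpow_of_exponent_ge hρ0 hρ1 (by linarith)
  -- Chernoff's exponent is at most `6 n ρ ^ (1 / 2) ≤ 1`.
  have hexp : Real.exp (Real.exp (-Real.log ρ / 2) * (n + 4 * n + 1) / ⌈ρ⁻¹⌉₊) ≤ 3 := by
    have hle : Real.exp (-Real.log ρ / 2) * (n + 4 * n + 1) / ⌈ρ⁻¹⌉₊ ≤ 1 := by
      set r := Real.exp (Real.log ρ / 2) with hr
      have hr0 : 0 < r := Real.exp_pos _
      have hr2 : r * r = ρ := by
        rw [hr, ← Real.exp_add, add_halves, Real.exp_log hρ0]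
      rw [div_le_one hM0, neg_div, Real.exp_neg, ← hr]
      refine le_trans ?_ hM1
      have h6 : 6 * n * r ≤ 1 := by
        refine abs_le_of_sq_le_sq' (a := 6 * n * r) (b := 1) ?_ zero_le_one |>.2
        calc (6 * n * r) ^ 2 = 36 * n ^ 2 * (r * r) := by ring
          _ ≤ 1 ^ 2 := by rw [hr2, one_pow]; exact hn8
      rw [← hr2, mul_inv]
      gcongr
      rw [← one_div, le_div_iff₀ hr0]
      nlinarith
    exact (Real.exp_le_exp.2 hle).trans (Real.exp_one_lt_d9.le.trans (by norm_num))
  have hdev : Real.exp (-(-Real.log ρ / 2 * (u - 1 - 1))) = ρ ^ ((u - 2) / 2) := by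
    rw [Real.rpow_def_of_pos hρ0]
    ring_nf
  rw [hdev]
  calc 2 * (D * ((n * ⌈ρ⁻¹⌉₊ : ℕ) : ℝ) ^ L *
      (Real.exp (Real.exp (-Real.log ρ / 2) * (n + 4 * n + 1) / ⌈ρ⁻¹⌉₊) * ρ ^ ((u - 2) / 2)))
      ≤ 2 * (D * ρ ^ (-(2 * u / 41)) * (3 * ρ ^ ((u - 2) / 2))) := by gcongr
    _ = D * (6 * ρ ^ (-(2 * u / 41) + (u - 2) / 2)) := by rw [Real.rpow_add hρ0]; ring
    _ ≤ D * (ρ ^ (-1 : ℝ) * ρ ^ (-(2 * u / 41) + (u - 2) / 2)) := by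
        gcongr
        rwa [Real.rpow_neg_one, ← one_div, le_div_iff₀ hρ0]
    _ = D * ρ ^ (-1 + (-(2 * u / 41) + (u - 2) / 2)) := by rw [← Real.rpow_add hρ0]
    _ ≤ _ := by
        gcongr D * ?_
        exact Real.rpow_le_rpow_of_exponent_ge hρ0 hρ1 (by linarith)

theorem theorem1 {X Ω : Type*} [MeasurableSpace X] [MeasurableSpace Ω]
    (P : Measure Ω) [IsProbabilityMeasure P]
    (F : Set (X → ℝ)) (hFc : F.Countable)
    (D L : ℝ) (hD : 1 ≤ D) (hL : 1 ≤ L) (hF : IsL1DenseClass F D L)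
    (hF1 : ∀ f ∈ F, ∀ x, |f x| ≤ 1)
    (n : ℕ) (hn : 2 ≤ n) (ξ : Fin n → Ω → X) (hξm : ∀ j, Measurable (ξ j))
    (hξi : iIndepFun ξ P) (μ : Measure X) (hξμ : ∀ j, P.map (ξ j) = μ)
    (ρ : ℝ) (hρ0 : 0 < ρ) (hρn : ρ ≤ (n : ℝ) ^ (-200 : ℤ))
    (hFρ : ∀ f ∈ F, ∫ x, |f x| ∂μ ≤ ρ)
    (u : ℝ) (hu : 41 * L < u) :
    P.real {ω | u ≤ ⨆ f : F, |∑ j, (f : X → ℝ) (ξ j ω)|} ≤ D * ρ ^ ((1 / 50 : ℝ) * u) := by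
  have hn0 : 0 < n := by omega
  have : Nonempty (Fin n) := ⟨⟨0, hn0⟩⟩
  have hμ : IsProbabilityMeasure μ := by
    rw [← hξμ ⟨0, hn0⟩]
    exact Measure.isProbabilityMeasure_map (hξm _).aemeasurable
  have hn2 : (2 : ℝ) ≤ n := by exact_mod_cast hn
  have hρ1 : ρ ≤ 1 := hρn.trans (zpow_le_one_of_nonpos₀ (by linarith) (by norm_num))
  have hMpos : 0 < ⌈ρ⁻¹⌉₊ := Nat.ceil_pos.2 (inv_pos.2 hρ0)
  have : Nonempty (Fin ⌈ρ⁻¹⌉₊) := ⟨⟨0, hMpos⟩⟩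
  have hlaw : P.map (fun ω j => ξ j ω) = Measure.pi fun _ : Fin n => μ := by
    rw [(iIndepFun_iff_map_fun_eq_pi_map fun j => (hξm j).aemeasurable).1 hξi]
    simp only [hξμ]
  -- The supremum need not be attained, hence the loss of `1`. For empty `F` it is `0`, below `u`.
  have hsub : {ω | u ≤ ⨆ f : F, |∑ j, (f : X → ℝ) (ξ j ω)|} ⊆
      (fun ω j => ξ j ω) ⁻¹' {x | ∃ f ∈ F, u - 1 < ∑ j, |f (x j)|} := by
    intro ω hω
    have hω : u ≤ ⨆ f : F, |∑ j, (f : X → ℝ) (ξ j ω)| := hω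
    rcases isEmpty_or_nonempty F with hE | hE
    · rw [Real.iSup_of_isEmpty] at hω
      linarith
    · obtain ⟨f, hf⟩ := exists_lt_of_lt_ciSup (lt_of_lt_of_le (sub_one_lt u) hω)
      exact ⟨f, f.2, hf.trans_le (Finset.abs_sum_le_sum_abs _ _)⟩
  have hξ : Measurable fun ω j => ξ j ω := measurable_pi_lambda _ hξm
  have hρa : 2 * (((Fintype.card (Fin n) * Fintype.card (Fin ⌈ρ⁻¹⌉₊) : ℕ) : ℝ) * ρ) ≤
      4 * n := by
    have hM2 : (⌈ρ⁻¹⌉₊ : ℝ) ≤ ρ⁻¹ + 1 := (Nat.ceil_lt_add_one (by positivity)).le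
    have h1 : (ρ⁻¹ + 1) * ρ = 1 + ρ := by field_simp
    rw [Fintype.card_fin, Fintype.card_fin, Nat.cast_mul]
    calc 2 * ((n : ℝ) * ⌈ρ⁻¹⌉₊ * ρ) ≤ 2 * (n * (ρ⁻¹ + 1) * ρ) := by gcongr
      _ = 2 * n * (1 + ρ) := by rw [← h1]; ring
      _ ≤ 4 * n := by nlinarith
  have ht : 0 ≤ -Real.log ρ / 2 := by
    have := Real.log_nonpos hρ0.le hρ1
    linarith
  have hbound := hF.measureReal_exists_lt_sum_le (α := Fin n) (κ := Fin ⌈ρ⁻¹⌉₊) hFc hF1 μ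
    hρ0.le hFρ (by positivity) hρa (u - 1) ht
  rw [Fintype.card_fin, Fintype.card_fin] at hbound
  calc P.real {ω | u ≤ ⨆ f : F, |∑ j, (f : X → ℝ) (ξ j ω)|}
      ≤ P.real ((fun ω j => ξ j ω) ⁻¹' {x | ∃ f ∈ F, u - 1 < ∑ j, |f (x j)|}) :=
        measureReal_mono hsub
    _ ≤ (Measure.pi fun _ : Fin n => μ).real {x | ∃ f ∈ F, u - 1 < ∑ j, |f (x j)|} := by
        rw [← hlaw]
        exact ENNReal.toReal_mono (by finiteness) (Measure.le_map_apply hξ.aemeasurable _)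
    _ ≤ _ := hbound.trans (two_mul_ghost_bound_le hn hD hL hρ0 hρn hu)
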